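/- For $0<\epsilon\le 1$ and a continuous map $f:[0,1]\to[0,1]$ consider the Markov chain on $[0,1]$ that moves from $x$ to a random point with the Gaussian law with mean $f(x)$ and standard deviation $\epsilon$, conditioned to $[0,1]$, that is, with density $y\mapsto C\,\frac{1}{\epsilon\sqrt{2\pi}}e^{-(y-f(x))^2/2\epsilon^2}$ on $[0,1]$, where $C=C_\epsilon(f(x))$ normalizes the mass to $1$. Let $\mu$ be its invariant probability measure. An algorithm is a deterministic Turing machine with a read-only input tape, a read-write work tape, a one-way write-only output tape, and access to $f$ on demand: it may write a dyadic $x\in[0,1]$ and a number $j$ on a write-only query tape (which is erased by the query) and obtains the $j$-th binary digit of $f(x)$. Its space is the number of cells of the work tape that it visits. For a fixed $K$ it is said to compute invariant measures if, for all $\epsilon=2^{-e}$, $\delta=2^{-n}$ ($e,n\in\mathbb{N}$), all dyadic $0\le a\le b\le1$ and all analytic $f:[0,1]\to[0,1]$ with $|\partial^k f(x)|\le k!\,\eta^k$ for all $k\ge0$ and $x\in[0,1]$, where $\eta=\epsilon^{-K}$, on input $(e,n,a,b)$ in binary it halts with a dyadic number within $\delta$ of $\mu([a,b])$. Theorem.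 There is a constant $K$ such that every algorithm that computes invariant measures for this $K$ requires space $\Omega(\log\frac1\epsilon+\log\log\frac1\delta)$. That is, for every such algorithm there are constants $c>0$ and $B$ such that for all $\epsilon=2^{-e}$ and $\delta=2^{-n}\le\frac14$ with $\log\frac1\epsilon+\log\log\frac1\delta\ge B$ there are an analytic map $f$ as above and an interval $[a,b]$ on which the algorithm, run with noise $\epsilon$ and precision $\delta$, uses space at least $c\,(\log\frac1\epsilon+\log\log\frac1\delta)$. -/

import Mathlib

namespace NoisySystem

noncomputable section

/-! ### Noisy dynamical systems on the unit interval -/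

/-- The density at `y` of the Gaussian with mean `x` and standard deviation `ε`. -/
def gaussDensity (ε y x : ℝ) : ℝ :=
  1 / (ε * Real.sqrt (2 * Real.pi)) * Real.exp (-(y - x) ^ 2 / (2 * ε ^ 2))

/-- The factor that normalizes the Gaussian centred at `x` to mass one on `[0,1]`. -/
def normFactor (ε x : ℝ) : ℝ :=
  (∫ y in (0 : ℝ)..1, gaussDensity ε y x)⁻¹

/-- The Gaussian noise kernel on `[0,1]`: density at `y`, for the centre `x`. -/
def noiseKernel (ε y x : ℝ) : ℝ :=
  normFactor ε x * gaussDensity ε y x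

/-- The noise measure at `x`, with density `noiseKernel ε · x` on `[0,1]`. -/
def noise (ε x : ℝ) : MeasureTheory.Measure ℝ :=
  (MeasureTheory.volume.restrict (Set.Icc (0 : ℝ) 1)).withDensity
    (fun y => ENNReal.ofReal (noiseKernel ε y x))

/-- `μ` is a probability measure on `[0,1]` that is invariant under the Markov chain which moves
from `x` to a random point distributed according to the noise measure at `f x`. -/
structure IsInvariantMeasure (ε : ℝ) (f : ℝ → ℝ) (μ : MeasureTheory.Measure ℝ) : Prop where
  prob : MeasureTheory.IsProbabilityMeasure μ
  supported : μ (Set.Icc (0 : ℝ) 1)ᶜ = 0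
  invariant : ∀ A : Set ℝ, MeasurableSet A → ∫⁻ x, noise ε (f x) A ∂μ = μ A

/-- `f` is an analytic map of `[0,1]` to itself whose `k`-th derivative is at most `k! η ^ k`
in absolute value on all of `[0,1]`, for every `k`. Values outside `[0,1]` play no role. -/
structure IsAnalyticMap (η : ℝ) (f : ℝ → ℝ) : Prop where
  mapsTo : Set.MapsTo f (Set.Icc 0 1) (Set.Icc 0 1)
  analytic : AnalyticOnNhd ℝ f (Set.Icc 0 1)
  bound : ∀ (k : ℕ), ∀ x ∈ Set.Icc (0 : ℝ) 1,
    |iteratedDeriv k f x| ≤ (Nat.factorial k : ℝ) * η ^ k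

/-! ### Binary strings as numbers -/

/-- The dyadic number with binary expansion `b₀.b₁b₂b₃…` (the first digit is the units digit). -/
def dyadic : List Bool → ℝ
  | [] => 0
  | b :: l => (if b then 1 else 0) + dyadic l / 2

/-- The natural number with binary digits `l`, least significant digit first
(a left inverse of `Nat.bits`). -/
def natOfBits : List Bool → ℕ
  | [] => 0
  | b :: l => Nat.bit b (natOfBits l)

/-! ### Space-bounded Turing machines with access to the digits of a real function -/

/-- Symbols of the input and query tapes: a bit, or the separator `none`. -/
abbrev Sym := Option Bool

/-- The digit with weight `2 ^ (-j)` of the binary expansion of `f x`, the answer to the query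
`w`, which consists of the binary expansion of `x`, a separator, and `j` in binary.
(Arguments above `1` are replaced by `1`.) -/
def answer (f : ℝ → ℝ) (w : List Sym) : Bool :=
  let x := dyadic (w.takeWhile Option.isSome).reduceOption
  let j := natOfBits (w.dropWhile Option.isSome).reduceOption
  decide (⌊(2 : ℝ) ^ j * f (min 1 x)⌋₊ % 2 = 1)

/-- Head movements. -/
inductive Move
  | left
  | stay
  | right

/-- New position of the head on a tape whose leftmost cell is number `0`. -/
def Move.apply : Move → ℕ → ℕ
  | Move.left, i => i - 1
  | Move.stay, i => i
  | Move.right, i => i + 1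

/-- What a machine does in one step: halt; or perform an ordinary step (new state, symbol written
on the work tape, movements of the work head and of the input head, a symbol to append to the
query tape if any, a bit to append to the output tape if any); or submit the query on the query
tape, which erases that tape, and enter a state that depends on the answer. -/
inductive Instruction (Q Γ : Type)
  | halt
  | act (next : Q) (write : Γ) (workMove inputMove : Move)
      (query : Option Sym) (output : Option Bool)
  | ask (next : Bool → Q)

/-- A deterministic Turing machine with a read-only input tape, a read-write work tape,
a one-way write-only output tape, and a one-way write-only query tape. Its next instruction
depends on the state, the scanned input symbol (`none` just beyond the right end of the input)
and the scanned work symbol. -/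
structure Machine where
  State : Type
  Work : Type
  finiteState : Finite State
  finiteWork : Finite Work
  start : State
  blank : Work
  instr : State → Option Sym → Work → Instruction State Work

/-- A configuration. -/
structure Config (A : Machine) where
  state : A.State
  inputPos : ℕ
  work : ℕ → A.Work
  workPos : ℕ
  query : List Sym
  output : List Bool

namespace Machine

variable (A : Machine)

/-- The initial configuration. -/
def init : Config A where
  state := A.start
  inputPos := 0
  work := fun _ => A.blank
  workPos := 0
  query := []
  output := []

/-- The instruction to be executed in the configuration `c` on the input word `inp`. -/
def current (inp : List Sym) (c : Config A) : Instruction A.State A.Work :=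
  A.instr c.state inp[c.inputPos]? (c.work c.workPos)

/-- One step of the machine on the input word `inp`, with queries answered from `f`. The input
head never goes more than one cell beyond the input. A halted configuration does not change. -/
def step (f : ℝ → ℝ) (inp : List Sym) (c : Config A) : Config A :=
  match A.current inp c with
  | Instruction.halt => c
  | Instruction.act next write workMove inputMove query output =>
      { state := next
        inputPos := min inp.length (inputMove.apply c.inputPos)
        work := Function.update c.work c.workPos write
        workPos := workMove.apply c.workPos
        query := c.query ++ query.toList
        output := c.output ++ output.toList }
  | Instruction.ask next =>
      { c with state := next (answer f c.query), query := [] }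

/-- The configuration after `t` steps. -/
def run (f : ℝ → ℝ) (inp : List Sym) (t : ℕ) : Config A :=
  (A.step f inp)^[t] A.init

/-- The machine halts with the word `out` on its output tape. -/
def HaltsWith (f : ℝ → ℝ) (inp : List Sym) (out : List Bool) : Prop :=
  ∃ t, A.current inp (A.run f inp t) = Instruction.halt ∧ (A.run f inp t).output = out

/-- The space used: the number of cells of the work tape visited during the run. -/
def space (f : ℝ → ℝ) (inp : List Sym) : ℕ∞ :=
  ⨆ t, (((A.run f inp t).workPos + 1 : ℕ) : ℕ∞)

end Machine

/-! ### The computational problem -/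

/-- The input word for noise `2 ^ (-e)`, precision `2 ^ (-n)` and the interval with endpoints
`dyadic a` and `dyadic b`: the word `#e#n#a#b`, with `e` and `n` in binary. -/
def inputWord (e n : ℕ) (a b : List Bool) : List Sym :=
  none :: (Nat.bits e).map some ++ none :: (Nat.bits n).map some ++
    none :: a.map some ++ none :: b.map some

/-- An instance of the problem: an analytic map `f` with `|∂ᵏ f| ≤ k! η ^ k`, where `η` is the
`K`-th power of `1 / ε` and `ε = 2 ^ (-e)`, and a dyadic interval contained in `[0,1]`. -/
structure IsInstance (K e : ℕ) (f : ℝ → ℝ) (a b : List Bool) : Prop where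
  map : IsAnalyticMap ((1 / (1 / 2 : ℝ) ^ e) ^ K) f
  le : dyadic a ≤ dyadic b
  le_one : dyadic b ≤ 1

/-- The machine computes invariant measures: with access to `f`, given `ε = 2 ^ (-e)`,
`δ = 2 ^ (-n)` and an interval, it halts with a dyadic number within `δ` of the weight of the
interval under the invariant measure of the system with map `f` and Gaussian noise `ε`. -/
def ComputesInvariantMeasures (K : ℕ) (A : Machine) : Prop :=
  ∀ (e n : ℕ) (f : ℝ → ℝ) (a b : List Bool), IsInstance K e f a b →
    ∃ out : List Bool, A.HaltsWith f (inputWord e n a b) out ∧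
      ∀ μ : MeasureTheory.Measure ℝ, IsInvariantMeasure ((1 / 2 : ℝ) ^ e) f μ →
        |dyadic out - μ.real (Set.Icc (dyadic a) (dyadic b))| ≤ (1 / 2 : ℝ) ^ n

/-- `log (1 / ε) + log log (1 / δ)`. -/
def spaceBound (ε δ : ℝ) : ℝ :=
  Real.log (1 / ε) + Real.log (Real.log (1 / δ))

end

end NoisySystem

/-!
A machine that halts in space `s` does so after at most exponentially many steps in `s`
(`Machine.IsHaltingTime.lt_sq`, `Machine.exists_log_le_space`). The query and output tapes are not
counted as space, but the query tape is erased by each query, so in a run that halts the bounded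
part of the configuration never recurs together with its value at the last time at which the query
tape was empty. Since the input word has
length `O(log (1 / ε) + log log (1 / δ))`, it remains to show that the running time is at least
exponential in that quantity (`ComputesInvariantMeasures.exists_spaceBound_le_log`), that is, at
least `1 / ε` and at least `n = log₂ (1 / δ)` on suitable constant maps, with the interval
`[0, 1 / 2]`.

* `ComputesInvariantMeasures.two_pow_lt_haltingTime`: for `K = 4`, if the algorithm made at most
  `1 / ε` steps on the constant map `1 / 4`, it could not distinguish it from the map
  `1 / 4 + 1 / 2 * ∏ (x - p)² / ((x - p)² + w²)`, where `p` runs through the points it asks about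
  and `w = 2 ε ^ 4`. The factors are bounded by `1` in a complex strip of half-width `w / 2`, so
  Cauchy's estimates give the required bounds on all derivatives (`isAnalyticMap_notch`) however
  many factors there are. As this map is close to `3 / 4` outside a set that is negligible even
  compared with `ε`, its invariant measure is concentrated near `3 / 4`, whereas that of the
  constant map is concentrated near `1 / 4`. That it has an invariant measure at all is Doeblin's
  theorem (`exists_invariant_density`).
* `ComputesInvariantMeasures.exists_le_haltingTime`: the invariant measure of `[0, 1 / 2]` for the
  constant map `u` is a continuous function of `u` and takes the value `1 / 2 + 2 δ`, which has no
  approximation within `δ` by a number with fewer than `n` binary digits.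
-/

namespace NoisySystem

/-! ### Running time of a space-bounded machine -/

namespace Machine

variable {A : Machine} {f g : ℝ → ℝ} {inp : List Sym}

theorem run_succ (A : Machine) (f : ℝ → ℝ) (inp : List Sym) (t : ℕ) :
    A.run f inp (t + 1) = A.step f inp (A.run f inp t) :=
  Function.iterate_succ_apply' _ _ _

/-- Two configurations agree in everything but the contents of the query and output tapes.
This is the part of a configuration that is bounded by the space used. -/
def SameCore (c c' : Config A) : Prop :=
  c.state = c'.state ∧ c.inputPos = c'.inputPos ∧ c.work = c'.work ∧ c.workPos = c'.workPos

theorem SameCore.current_eq {c c' : Config A} (h : SameCore c c') :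
    A.current inp c = A.current inp c' := by
  obtain ⟨h1, h2, h3, h4⟩ := h
  simp only [current, h1, h2, h3, h4]

theorem SameCore.step {c c' : Config A} (h : SameCore c c')
    (hask : ∀ next, A.current inp c ≠ Instruction.ask next) :
    SameCore (A.step f inp c) (A.step f inp c') := by
  have hc : A.current inp c = A.current inp c' := h.current_eq
  obtain ⟨h1, h2, h3, h4⟩ := h
  unfold Machine.step
  rw [← hc]
  cases hi : A.current inp c with
  | halt => exact ⟨h1, h2, h3, h4⟩
  | act next write wm im q o => simp only [SameCore, h2, h3, h4, and_self]
  | ask next => exact absurd hi (hask next)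

theorem SameCore.step_of_query_eq {c c' : Config A} (h : SameCore c c')
    (hq : c.query = c'.query) :
    SameCore (A.step f inp c) (A.step f inp c') ∧
      (A.step f inp c).query = (A.step f inp c').query := by
  have hc : A.current inp c = A.current inp c' := h.current_eq
  obtain ⟨h1, h2, h3, h4⟩ := h
  unfold Machine.step
  rw [← hc]
  cases hi : A.current inp c with
  | halt => exact ⟨⟨h1, h2, h3, h4⟩, hq⟩
  | act next write wm im q o => simp only [SameCore, h2, h3, h4, hq, and_self]
  | ask next => simp only [SameCore, h2, h3, h4, hq, and_self]

theorem query_run_succ_of_ask {t : ℕ} {next : Bool → A.State}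
    (h : A.current inp (A.run f inp t) = Instruction.ask next) :
    (A.run f inp (t + 1)).query = [] := by
  rw [run_succ, step, h]

theorem inputPos_run_le (t : ℕ) : (A.run f inp t).inputPos ≤ inp.length := by
  induction t with
  | zero => exact Nat.zero_le _
  | succ t ih =>
    rw [run_succ, step]
    cases A.current inp (A.run f inp t) with
    | halt => exact ih
    | act => exact min_le_left _ _
    | ask => exact ih

theorem length_output_run_le (t : ℕ) : (A.run f inp t).output.length ≤ t := by
  induction t with
  | zero => exact le_rfl
  | succ t ih =>
    rw [run_succ, step]
    cases A.current inp (A.run f inp t) with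
    | halt => exact ih.trans (Nat.le_succ t)
    | act next write wm im q o =>
      cases o <;> simp <;> omega
    | ask => exact ih.trans (Nat.le_succ t)

theorem work_run_eq_blank {s : ℕ} (hs : ∀ t, (A.run f inp t).workPos < s) (t : ℕ) {i : ℕ}
    (hi : s ≤ i) : (A.run f inp t).work i = A.blank := by
  induction t with
  | zero => rfl
  | succ t ih =>
    rw [run_succ, step]
    cases A.current inp (A.run f inp t) with
    | halt => exact ih
    | act next write wm im q o =>
      have : i ≠ (A.run f inp t).workPos := ((hs t).trans_le hi).ne'
      simpa [Function.update_of_ne this] using ih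
    | ask => exact ih

theorem run_eq_of_halted {t u : ℕ} (htu : t ≤ u)
    (h : A.current inp (A.run f inp t) = Instruction.halt) :
    A.run f inp u = A.run f inp t := by
  induction u, htu using Nat.le_induction with
  | base => rfl
  | succ u _ ih => rw [run_succ, ih, step, h]

theorem HaltsWith.unique {out out' : List Bool} (h : A.HaltsWith f inp out)
    (h' : A.HaltsWith f inp out') : out = out' := by
  obtain ⟨t, ht, rfl⟩ := h
  obtain ⟨u, hu, rfl⟩ := h'
  rcases le_total t u with htu | htu
  · rw [run_eq_of_halted htu ht]
  · rw [run_eq_of_halted htu hu]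

/-- `T` is the first time at which the machine is halted. -/
def IsHaltingTime (A : Machine) (f : ℝ → ℝ) (inp : List Sym) (T : ℕ) : Prop :=
  A.current inp (A.run f inp T) = Instruction.halt ∧
    ∀ t < T, A.current inp (A.run f inp t) ≠ Instruction.halt

theorem HaltsWith.exists_isHaltingTime {out : List Bool} (h : A.HaltsWith f inp out) :
    ∃ T, A.IsHaltingTime f inp T ∧ (A.run f inp T).output = out := by
  classical
  obtain ⟨t, ht, rfl⟩ := h
  have hex : ∃ t, A.current inp (A.run f inp t) = Instruction.halt := ⟨t, ht⟩
  refine ⟨Nat.find hex, ⟨Nat.find_spec hex, fun t h => Nat.find_min hex h⟩, ?_⟩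
  rw [run_eq_of_halted (Nat.find_min' hex ht) (Nat.find_spec hex)]

/-- Maps that give the same answers to the queries of a run cannot be told apart by that run. -/
theorem run_congr {T : ℕ}
    (h : ∀ t < T, answer f (A.run f inp t).query = answer g (A.run f inp t).query) :
    ∀ t ≤ T, A.run g inp t = A.run f inp t := by
  intro t
  induction t with
  | zero => exact fun _ => rfl
  | succ t ih =>
    intro ht
    rw [run_succ, run_succ, ih (by omega), step, step, h t ht]

/-- A run in which a configuration recurs, up to the contents of the output tape, has halted
before or never halts. -/
theorem IsHaltingTime.not_sameCore_of_query_eq {T t u : ℕ} (hT : A.IsHaltingTime f inp T)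
    (htu : t < u) (huT : u ≤ T) (hc : SameCore (A.run f inp t) (A.run f inp u))
    (hq : (A.run f inp t).query = (A.run f inp u).query) : False := by
  have key : ∀ k, SameCore (A.run f inp (t + k)) (A.run f inp (u + k)) ∧
      (A.run f inp (t + k)).query = (A.run f inp (u + k)).query := by
    intro k
    induction k with
    | zero => exact ⟨hc, hq⟩
    | succ k ih =>
      rw [← add_assoc, ← add_assoc, run_succ, run_succ]
      exact ih.1.step_of_query_eq ih.2
  refine hT.2 (t + (T - u)) (by omega) ?_
  rw [(key (T - u)).1.current_eq, Nat.add_sub_cancel' huT, hT.1]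

/-- If the space-bounded part of the configuration recurs and no query is submitted meanwhile,
the machine goes on like this for ever, without ever asking again. -/
theorem IsHaltingTime.not_sameCore_of_no_ask {T t u : ℕ} (hT : A.IsHaltingTime f inp T)
    (htu : t < u) (huT : u ≤ T) (hc : SameCore (A.run f inp t) (A.run f inp u))
    (hask : ∀ v, t ≤ v → v < u → ∀ next, A.current inp (A.run f inp v) ≠ Instruction.ask next) :
    False := by
  have key : ∀ k, SameCore (A.run f inp (t + k)) (A.run f inp (u + k)) ∧
      ∀ next, A.current inp (A.run f inp (t + k)) ≠ Instruction.ask next := by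
    intro k
    induction k using Nat.strong_induction_on with
    | _ k ih =>
      have h1 : SameCore (A.run f inp (t + k)) (A.run f inp (u + k)) := by
        cases k with
        | zero => exact hc
        | succ k =>
          rw [← add_assoc, ← add_assoc, run_succ, run_succ]
          exact (ih k (by omega)).1.step (ih k (by omega)).2
      refine ⟨h1, fun next => ?_⟩
      by_cases hk : t + k < u
      · exact hask _ (by omega) hk next
      · -- The configuration at time `t + k` repeats the one a period `u - t` before.
        obtain ⟨h2, h3⟩ := ih (t + k - u) (by omega)
        rw [h2.current_eq, Nat.add_sub_cancel' (not_lt.mp hk)] at h3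
        exact h3 next
  refine hT.2 (t + (T - u)) (by omega) ?_
  rw [(key (T - u)).1.current_eq, Nat.add_sub_cancel' huT, hT.1]

/-- A machine that halts after visiting only `s` cells does so within the square of the number of
values of the space-bounded part of its configurations. The square is needed because the query
tape is not bounded by the space: a time is determined by that part of the configuration together
with its value at the last time at which the query tape was empty. -/
theorem IsHaltingTime.lt_sq {T s : ℕ} (hT : A.IsHaltingTime f inp T)
    (hs : ∀ t, (A.run f inp t).workPos < s) :
    T < (Nat.card A.State * ((inp.length + 1) * (Nat.card A.Work ^ s * s))) ^ 2 := by
  classical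
  have := A.finiteState
  have := A.finiteWork
  let core : ℕ → A.State × Fin (inp.length + 1) × (Fin s → A.Work) × Fin s := fun t =>
    ((A.run f inp t).state, ⟨(A.run f inp t).inputPos, Nat.lt_succ_of_le (inputPos_run_le t)⟩,
      fun i => (A.run f inp t).work i, ⟨(A.run f inp t).workPos, hs t⟩)
  have hcore : ∀ t u, core t = core u → SameCore (A.run f inp t) (A.run f inp u) := by
    intro t u h
    simp only [core, Prod.mk.injEq, Fin.mk.injEq] at h
    obtain ⟨h1, h2, h3, h4⟩ := h
    refine ⟨h1, h2, funext fun i => ?_, h4⟩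
    by_cases hi : i < s
    · exact congrFun h3 ⟨i, hi⟩
    · rw [work_run_eq_blank hs t (not_lt.mp hi), work_run_eq_blank hs u (not_lt.mp hi)]
  let P : ℕ → Prop := fun r => (A.run f inp r).query = []
  let last : ℕ → ℕ := Nat.findGreatest P
  have hP : ∀ t, P (last t) := fun t => Nat.findGreatest_spec (Nat.zero_le t) rfl
  have hinj : ∀ t u, t < u → u ≤ T → core t = core u → core (last t) = core (last u) → False := by
    intro t u htu huT h1 h2
    have hmono : last t ≤ last u := Nat.findGreatest_mono_right P htu.le
    have hu : last u ≤ u := Nat.findGreatest_le u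
    rcases hmono.eq_or_lt with he | hlt
    · refine hT.not_sameCore_of_no_ask htu huT (hcore _ _ h1) fun v hv hvu next hask => ?_
      have h3 : v + 1 ≤ last u := Nat.le_findGreatest hvu (query_run_succ_of_ask hask)
      have h4 : last t ≤ t := Nat.findGreatest_le t
      omega
    · exact hT.not_sameCore_of_query_eq hlt (hu.trans huT) (hcore _ _ h2)
        ((hP t).trans (hP u).symm)
  have hinj' : Function.Injective (fun t : Fin (T + 1) => (core t, core (last t))) := by
    intro t u h
    obtain ⟨h1, h2⟩ := Prod.mk.inj h
    rcases lt_trichotomy (t : ℕ) u with hlt | he | hlt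
    · exact (hinj t u hlt (by omega) h1 h2).elim
    · exact Fin.ext he
    · exact (hinj u t hlt (by omega) h1.symm h2.symm).elim
  have hcard := Nat.card_le_card_of_injective _ hinj'
  simp only [Nat.card_prod, Nat.card_fun, Nat.card_eq_fintype_card, Fintype.card_fin] at hcard
  rw [sq]
  simpa using hcard

/-- For a fixed machine, the logarithm of the running time is at most linear in the space, up to
a term for the number of positions of the input head. -/
theorem exists_log_le_space (A : Machine) : ∃ C : ℝ, 0 < C ∧
    ∀ (f : ℝ → ℝ) (inp : List Sym) (T s : ℕ), A.IsHaltingTime f inp T → 1 ≤ T →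
      (∀ t, (A.run f inp t).workPos < s) →
        Real.log T ≤ C * s + 2 * Real.log (inp.length + 1) := by
  have := A.finiteState
  have := A.finiteWork
  have hQ : 1 ≤ Nat.card A.State := Nat.card_pos_iff.mpr ⟨⟨A.start⟩, inferInstance⟩
  have hW : 1 ≤ Nat.card A.Work := Nat.card_pos_iff.mpr ⟨⟨A.blank⟩, inferInstance⟩
  have hQ' : 0 ≤ Real.log (Nat.card A.State) := Real.log_nonneg (by exact_mod_cast hQ)
  have hW' : 0 ≤ Real.log (Nat.card A.Work) := Real.log_nonneg (by exact_mod_cast hW)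
  refine ⟨2 * (Real.log (Nat.card A.State) + Real.log (Nat.card A.Work) + 1), by positivity, ?_⟩
  intro f inp T s hT hT1 hs
  have hs1 : 1 ≤ s := (Nat.zero_le _).trans_lt (hs 0)
  have hs1' : (1 : ℝ) ≤ s := by exact_mod_cast hs1
  have hT0 : (0 : ℝ) < T := by exact_mod_cast hT1
  have hlt : (T : ℝ) ≤ (Nat.card A.State * ((inp.length + 1) * (Nat.card A.Work ^ s * s))) ^ 2 := by
    exact_mod_cast (hT.lt_sq hs).le
  have hQ0 : (Nat.card A.State : ℝ) ≠ 0 := by positivity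
  have hW0 : (Nat.card A.Work : ℝ) ≠ 0 := by positivity
  have hlog := Real.log_le_log hT0 hlt
  rw [Real.log_pow, Real.log_mul hQ0 (by positivity), Real.log_mul (by positivity) (by positivity),
    Real.log_mul (by positivity) (by positivity), Real.log_pow] at hlog
  have h1 : Real.log s ≤ s := (Real.log_le_sub_one_of_pos (by positivity)).trans (by linarith)
  have h2 := mul_le_mul_of_nonneg_left hs1' hQ'
  push_cast at hlog
  nlinarith

end Machine

/-! ### The noise kernel -/

open MeasureTheory Set

/-- The Gaussian density without its normalizing factor. -/
noncomputable def gaussWeight (ε y u : ℝ) : ℝ :=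
  Real.exp (-(y - u) ^ 2 / (2 * ε ^ 2))

theorem continuous_gaussWeight (ε : ℝ) : Continuous fun p : ℝ × ℝ => gaussWeight ε p.1 p.2 := by
  unfold gaussWeight
  fun_prop

theorem intervalIntegrable_gaussWeight (ε u a b : ℝ) :
    IntervalIntegrable (fun y => gaussWeight ε y u) volume a b :=
  ((continuous_gaussWeight ε).comp (by fun_prop : Continuous fun y : ℝ =>
    (y, u))).intervalIntegrable a b

theorem continuous_integral_gaussWeight (ε a b : ℝ) :
    Continuous fun u => ∫ y in a..b, gaussWeight ε y u :=
  intervalIntegral.continuous_parametric_intervalIntegral_of_continuous'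
    (f := fun u y => gaussWeight ε y u) ((continuous_gaussWeight ε).comp continuous_swap) a b

theorem gaussWeight_pos (ε y u : ℝ) : 0 < gaussWeight ε y u := Real.exp_pos _

theorem gaussWeight_le_one (ε y u : ℝ) : gaussWeight ε y u ≤ 1 := by
  refine Real.exp_le_one_iff.mpr ?_
  rw [neg_div, Left.neg_nonpos_iff]
  positivity

theorem integral_gaussWeight_le_one (ε u : ℝ) : ∫ y in (0 : ℝ)..1, gaussWeight ε y u ≤ 1 := by
  have := intervalIntegral.integral_mono_on zero_le_one (intervalIntegrable_gaussWeight ε u 0 1)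
    (intervalIntegrable_const (c := (1 : ℝ))) fun y _ => gaussWeight_le_one ε y u
  simpa using this

/-- The Gaussian weight is at least `7 / 8` within half a standard deviation of its centre, and
`[0,1]` contains half of this neighbourhood. -/
theorem le_integral_gaussWeight {ε u : ℝ} (hε : 0 < ε) (hε1 : ε ≤ 1) (hu : u ∈ Icc (0 : ℝ) 1) :
    7 * ε / 16 ≤ ∫ y in (0 : ℝ)..1, gaussWeight ε y u := by
  obtain ⟨p, hp0, hp1, hp⟩ : ∃ p : ℝ, 0 ≤ p ∧ p + ε / 2 ≤ 1 ∧
      ∀ y ∈ Icc p (p + ε / 2), (y - u) ^ 2 ≤ (ε / 2) ^ 2 := by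
    rcases le_total u (1 / 2) with h | h
    · refine ⟨u, hu.1, by linarith, fun y hy => ?_⟩
      exact pow_le_pow_left₀ (by linarith [hy.1]) (by linarith [hy.2]) 2
    · refine ⟨u - ε / 2, by linarith, by linarith [hu.2], fun y hy => ?_⟩
      rw [← neg_sq, neg_sub]
      exact pow_le_pow_left₀ (by linarith [hy.2]) (by linarith [hy.1]) 2
  have hW : ∀ y ∈ Icc p (p + ε / 2), 7 / 8 ≤ gaussWeight ε y u := by
    intro y hy
    have h1 : -(1 / 8) ≤ -(y - u) ^ 2 / (2 * ε ^ 2) := by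
      rw [le_div_iff₀ (by positivity)]
      nlinarith [hp y hy]
    have h2 := Real.add_one_le_exp (-(y - u) ^ 2 / (2 * ε ^ 2))
    unfold gaussWeight
    linarith
  calc 7 * ε / 16 = ∫ _ in p..(p + ε / 2), (7 / 8 : ℝ) := by
        rw [intervalIntegral.integral_const, smul_eq_mul]; ring
    _ ≤ ∫ y in p..(p + ε / 2), gaussWeight ε y u :=
        intervalIntegral.integral_mono_on (by linarith) intervalIntegrable_const
          (intervalIntegrable_gaussWeight ε u _ _) hW
    _ ≤ ∫ y in (0 : ℝ)..1, gaussWeight ε y u :=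
        intervalIntegral.integral_mono_interval hp0 (by linarith) hp1
          (Filter.Eventually.of_forall fun y => (gaussWeight_pos ε y u).le)
          (intervalIntegrable_gaussWeight ε u 0 1)

theorem integral_gaussWeight_pos (ε u : ℝ) : 0 < ∫ y in (0 : ℝ)..1, gaussWeight ε y u :=
  intervalIntegral.intervalIntegral_pos_of_pos (intervalIntegrable_gaussWeight ε u 0 1)
    (fun y => gaussWeight_pos ε y u) zero_lt_one

theorem noiseKernel_eq {ε : ℝ} (hε : 0 < ε) (y u : ℝ) :
    noiseKernel ε y u = gaussWeight ε y u / ∫ y in (0 : ℝ)..1, gaussWeight ε y u := by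
  have h : ∀ y, gaussDensity ε y u = 1 / (ε * Real.sqrt (2 * Real.pi)) * gaussWeight ε y u :=
    fun _ => rfl
  have hc : 1 / (ε * Real.sqrt (2 * Real.pi)) ≠ 0 := by positivity
  unfold noiseKernel normFactor
  simp only [h]
  rw [intervalIntegral.integral_const_mul, mul_inv, mul_mul_mul_comm, inv_mul_cancel₀ hc, one_mul,
    inv_mul_eq_div]

theorem noiseKernel_nonneg {ε : ℝ} (hε : 0 < ε) (y u : ℝ) : 0 ≤ noiseKernel ε y u := by
  rw [noiseKernel_eq hε]
  exact div_nonneg (gaussWeight_pos ε y u).le (integral_gaussWeight_pos ε u).le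

theorem measurable_noiseKernel {ε : ℝ} (hε : 0 < ε) :
    Measurable fun p : ℝ × ℝ => noiseKernel ε p.1 p.2 := by
  simp only [noiseKernel_eq hε]
  exact (continuous_gaussWeight ε).measurable.div
    ((continuous_integral_gaussWeight ε 0 1).measurable.comp measurable_snd)

theorem noiseKernel_le {ε u : ℝ} (hε : 0 < ε) (hε1 : ε ≤ 1) (hu : u ∈ Icc (0 : ℝ) 1) (y : ℝ) :
    noiseKernel ε y u ≤ 16 / (7 * ε) := by
  rw [noiseKernel_eq hε, show 16 / (7 * ε) = 1 / (7 * ε / 16) by field_simp]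
  exact div_le_div₀ zero_le_one (gaussWeight_le_one ε y u) (by positivity)
    (le_integral_gaussWeight hε hε1 hu)

/-- Away from its centre the noise has small density. The linear bound is far from optimal. -/
theorem noiseKernel_le_of_far {ε u y : ℝ} (hε : 0 < ε) (hε1 : ε ≤ 1) (hu : u ∈ Icc (0 : ℝ) 1)
    (hy : 1 / 8 ≤ |y - u|) : noiseKernel ε y u ≤ 300 * ε := by
  have hW : gaussWeight ε y u ≤ 128 * ε ^ 2 := by
    have h1 : 1 / (128 * ε ^ 2) ≤ (y - u) ^ 2 / (2 * ε ^ 2) := by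
      have : (1 / 8) ^ 2 ≤ (y - u) ^ 2 := by
        rw [← sq_abs (y - u)]
        exact pow_le_pow_left₀ (by norm_num) hy 2
      rw [div_le_div_iff₀ (by positivity) (by positivity)]
      nlinarith [sq_nonneg ε]
    have h2 := Real.add_one_le_exp ((y - u) ^ 2 / (2 * ε ^ 2))
    unfold gaussWeight
    rw [neg_div, Real.exp_neg]
    refine inv_le_of_inv_le₀ (by positivity) ?_
    rw [← one_div]
    linarith
  rw [noiseKernel_eq hε, div_le_iff₀ (integral_gaussWeight_pos ε u)]
  have h3 := le_integral_gaussWeight hε hε1 hu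
  nlinarith [mul_le_mul_of_nonneg_left h3 hε.le]

theorem exp_le_noiseKernel {ε u y : ℝ} (hε : 0 < ε) (hu : u ∈ Icc (0 : ℝ) 1)
    (hy : y ∈ Icc (0 : ℝ) 1) : Real.exp (-1 / (2 * ε ^ 2)) ≤ noiseKernel ε y u := by
  rw [noiseKernel_eq hε, le_div_iff₀ (integral_gaussWeight_pos ε u)]
  have h1 : Real.exp (-1 / (2 * ε ^ 2)) ≤ gaussWeight ε y u := by
    refine Real.exp_le_exp.mpr (div_le_div_of_nonneg_right ?_ (by positivity))
    nlinarith [hu.1, hu.2, hy.1, hy.2]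
  have h2 := integral_gaussWeight_le_one ε u
  nlinarith [Real.exp_pos (-1 / (2 * ε ^ 2))]

theorem noise_apply (ε u : ℝ) {A : Set ℝ} (hA : MeasurableSet A) :
    noise ε u A = ∫⁻ y in A ∩ Icc 0 1, ENNReal.ofReal (noiseKernel ε y u) := by
  rw [noise, withDensity_apply _ hA, Measure.restrict_restrict hA]

theorem noise_Icc {ε a b : ℝ} (hε : 0 < ε) (ha : 0 ≤ a) (hab : a ≤ b) (hb : b ≤ 1) (u : ℝ) :
    noise ε u (Icc a b) = ENNReal.ofReal
      ((∫ y in a..b, gaussWeight ε y u) / ∫ y in (0 : ℝ)..1, gaussWeight ε y u) := by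
  have hint : IntervalIntegrable (fun y => noiseKernel ε y u) volume a b := by
    simp only [noiseKernel_eq hε]
    exact (intervalIntegrable_gaussWeight ε u a b).div_const _
  rw [noise_apply ε u measurableSet_Icc,
    inter_eq_self_of_subset_left (Icc_subset_Icc ha hb), ← intervalIntegral.integral_div,
    ← ofReal_integral_eq_lintegral_ofReal
      ((intervalIntegrable_iff_integrableOn_Icc_of_le hab).mp hint)
      (Filter.Eventually.of_forall fun y => noiseKernel_nonneg hε y u),
    integral_Icc_eq_integral_Ioc, ← intervalIntegral.integral_of_le hab]
  simp only [noiseKernel_eq hε]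

theorem noise_univ {ε : ℝ} (hε : 0 < ε) (u : ℝ) : noise ε u univ = 1 := by
  have h := noise_Icc hε le_rfl zero_le_one le_rfl u
  rw [div_self (integral_gaussWeight_pos ε u).ne', ENNReal.ofReal_one] at h
  rw [← h, noise_apply ε u MeasurableSet.univ, noise_apply ε u measurableSet_Icc, univ_inter,
    inter_self]

theorem isProbabilityMeasure_noise {ε : ℝ} (hε : 0 < ε) (u : ℝ) :
    IsProbabilityMeasure (noise ε u) := ⟨noise_univ hε u⟩

theorem noise_compl_Icc (ε u : ℝ) : noise ε u (Icc 0 1)ᶜ = 0 := by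
  rw [noise_apply ε u measurableSet_Icc.compl, compl_inter_self]
  simp

theorem noise_le_mul_volume {ε u M : ℝ} {A : Set ℝ} (hA : MeasurableSet A)
    (h : ∀ y ∈ A ∩ Icc (0 : ℝ) 1, noiseKernel ε y u ≤ M) :
    noise ε u A ≤ ENNReal.ofReal M * volume (A ∩ Icc 0 1) := by
  rw [noise_apply ε u hA, ← setLIntegral_const]
  exact setLIntegral_mono' (hA.inter measurableSet_Icc) fun y hy =>
    ENNReal.ofReal_le_ofReal (h y hy)

/-- The noise rarely jumps further than `1 / 8`. -/
theorem noise_le_of_far {ε u : ℝ} {A : Set ℝ} (hε : 0 < ε) (hε1 : ε ≤ 1)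
    (hu : u ∈ Icc (0 : ℝ) 1) (hA : MeasurableSet A) (h : ∀ y ∈ A, 1 / 8 ≤ |y - u|) :
    noise ε u A ≤ ENNReal.ofReal (300 * ε) := by
  refine (noise_le_mul_volume hA fun y hy => noiseKernel_le_of_far hε hε1 hu (h y hy.1)).trans ?_
  have : volume (A ∩ Icc (0 : ℝ) 1) ≤ 1 :=
    (measure_mono inter_subset_right).trans (by simp)
  exact (mul_le_mul_right this _).trans (mul_one _).le

/-! ### Existence of invariant measures -/

open scoped ENNReal

section Doeblin

variable {X : Type*} [MeasurableSpace X] (ν : Measure X) (q : X → X → ℝ≥0∞) (a : ℝ≥0∞)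

/-- For a Markov kernel with density `a + q x y`, the density at `y` of the event that the last
regeneration (a move that ignores the starting point) happened exactly `k` steps ago. -/
noncomputable def regenerationDensity : ℕ → X → ℝ≥0∞
  | 0 => fun _ => a
  | k + 1 => fun y => ∫⁻ x, regenerationDensity k x * q x y ∂ν

variable {ν q a} [IsProbabilityMeasure ν]

theorem measurable_regenerationDensity (hq : Measurable (Function.uncurry q)) (k : ℕ) :
    Measurable (regenerationDensity ν q a k) := by
  induction k with
  | zero => exact measurable_const
  | succ k ih =>
    exact Measurable.lintegral_prod_left'
      (f := fun p : X × X => regenerationDensity ν q a k p.1 * q p.1 p.2)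
      ((ih.comp measurable_fst).mul hq)

/-- **Doeblin's theorem** (existence part): a Markov kernel whose density is bounded below by a
positive constant has an invariant probability density, the sum of the densities over all
possible times since the last regeneration. -/
theorem exists_invariant_density (hq : Measurable (Function.uncurry q)) (ha : a ≠ 0)
    (h : ∀ x, ∫⁻ y, (a + q x y) ∂ν = 1) :
    ∃ ρ : X → ℝ≥0∞, Measurable ρ ∧ ∫⁻ x, ρ x ∂ν = 1 ∧
      ∀ y, ∫⁻ x, ρ x * (a + q x y) ∂ν = ρ y := by
  have hm := measurable_regenerationDensity (ν := ν) (a := a) hq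
  have hqx : ∀ x, Measurable (q x) := fun x => hq.comp measurable_prodMk_left
  have hqy : ∀ y, Measurable fun x => q x y := fun y => hq.comp measurable_prodMk_right
  have hsplit : ∀ x, a + ∫⁻ y, q x y ∂ν = 1 := by
    intro x
    have := h x
    rwa [lintegral_add_left measurable_const, lintegral_const, measure_univ, mul_one] at this
  obtain ⟨x₀⟩ : Nonempty X := nonempty_of_isProbabilityMeasure ν
  have ha1 : a ≤ 1 := (hsplit x₀).le.trans' le_self_add
  have hat : a ≠ ∞ := ne_top_of_le_ne_top ENNReal.one_ne_top ha1
  have hb : ∀ x, ∫⁻ y, q x y ∂ν = 1 - a := fun x =>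
    (ENNReal.sub_eq_of_eq_add_rev hat (hsplit x).symm).symm
  have hmass : ∀ k, ∫⁻ y, regenerationDensity ν q a k y ∂ν = a * (1 - a) ^ k := by
    intro k
    induction k with
    | zero => simp [regenerationDensity]
    | succ k ih =>
      simp only [regenerationDensity]
      rw [lintegral_lintegral_swap]
      · have : ∀ x, ∫⁻ y, regenerationDensity ν q a k x * q x y ∂ν
            = regenerationDensity ν q a k x * (1 - a) := fun x => by
          rw [lintegral_const_mul _ (hqx x), hb]
        simp only [this]
        rw [lintegral_mul_const _ (hm k), ih, pow_succ, mul_assoc]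
      · exact (((hm k).comp measurable_snd).mul (hq.comp measurable_swap)).aemeasurable
  have htotal : ∫⁻ y, ∑' k, regenerationDensity ν q a k y ∂ν = 1 := by
    rw [lintegral_tsum fun k => (hm k).aemeasurable]
    simp only [hmass]
    rw [ENNReal.tsum_mul_left, ENNReal.tsum_geometric,
      ENNReal.sub_sub_cancel ENNReal.one_ne_top ha1,
      ENNReal.mul_inv_cancel ha hat]
  have hρ : Measurable fun y => ∑' k, regenerationDensity ν q a k y :=
    Measurable.tsum hm
  refine ⟨_, hρ, htotal, fun y => ?_⟩
  simp only [mul_add]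
  rw [lintegral_add_left (hρ.mul_const a), lintegral_mul_const _ hρ, htotal, one_mul]
  simp only [← ENNReal.tsum_mul_right]
  rw [lintegral_tsum (f := fun k x => regenerationDensity ν q a k x * q x y)
      fun k => ((hm k).mul (hqy y)).aemeasurable,
    tsum_eq_zero_add' (f := fun k => regenerationDensity ν q a k y) ENNReal.summable]
  rfl

end Doeblin

theorem exists_isInvariantMeasure {ε : ℝ} {f : ℝ → ℝ} (hε : 0 < ε) (hf : Measurable f)
    (hfI : ∀ x, f x ∈ Icc (0 : ℝ) 1) : ∃ μ, IsInvariantMeasure ε f μ := by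
  obtain ⟨ν, hν⟩ : ∃ ν : Measure ℝ, ν = volume.restrict (Icc (0 : ℝ) 1) := ⟨_, rfl⟩
  have : IsProbabilityMeasure ν := ⟨by simp [hν]⟩
  obtain ⟨α, hα⟩ : ∃ α, α = Real.exp (-1 / (2 * ε ^ 2)) := ⟨_, rfl⟩
  have hα0 : 0 < α := hα ▸ Real.exp_pos _
  obtain ⟨q, hqdef⟩ : ∃ q : ℝ → ℝ → ℝ≥0∞,
      ∀ x y, q x y = ENNReal.ofReal (noiseKernel ε y (f x) - α) := ⟨_, fun _ _ => rfl⟩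
  have hq : Measurable (Function.uncurry q) := by
    simp only [Function.uncurry_def, hqdef]
    exact (((measurable_noiseKernel hε).comp
      (measurable_snd.prodMk (hf.comp measurable_fst))).sub_const α).ennreal_ofReal
  have hqx : ∀ x, Measurable (q x) := fun x => hq.comp measurable_prodMk_left
  obtain ⟨a, hadef⟩ : ∃ a, a = ENNReal.ofReal α := ⟨_, rfl⟩
  have hnoise : ∀ x {A : Set ℝ}, MeasurableSet A →
      noise ε (f x) A = ∫⁻ y in A, (a + q x y) ∂ν := by
    intro x A hA
    rw [noise_apply ε _ hA, hν, Measure.restrict_restrict hA]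
    refine setLIntegral_congr_fun (hA.inter measurableSet_Icc) fun y hy => ?_
    have h1 : α ≤ _ := hα.trans_le (exp_le_noiseKernel hε (hfI x) hy.2)
    rw [hadef, hqdef, ← ENNReal.ofReal_add hα0.le (sub_nonneg.mpr h1), add_sub_cancel]
  have ha : a ≠ 0 := by rw [hadef]; exact (ENNReal.ofReal_pos.mpr hα0).ne'
  obtain ⟨ρ, hρ, hρ1, hρi⟩ := exists_invariant_density (ν := ν) hq ha fun x => by
    rw [← setLIntegral_univ, ← hnoise x MeasurableSet.univ, noise_univ hε]
  refine ⟨ν.withDensity ρ, ⟨by simpa using hρ1⟩, ?_, fun A hA => ?_⟩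
  · refine withDensity_absolutelyContinuous ν ρ ?_
    rw [hν, Measure.restrict_apply measurableSet_Icc.compl]
    simp
  · have haq : Measurable fun p : ℝ × ℝ => a + q p.1 p.2 := hq.const_add a
    simp only [hnoise _ hA]
    rw [lintegral_withDensity_eq_lintegral_mul _ hρ
      (Measurable.lintegral_prod_right' (ν := ν.restrict A) haq), withDensity_apply _ hA]
    calc ∫⁻ x, ρ x * ∫⁻ y in A, (a + q x y) ∂ν ∂ν
        = ∫⁻ x, ∫⁻ y in A, ρ x * (a + q x y) ∂ν ∂ν :=
          lintegral_congr fun x => (lintegral_const_mul _ ((hqx x).const_add a)).symm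
      _ = ∫⁻ y in A, ∫⁻ x, ρ x * (a + q x y) ∂ν ∂ν :=
          lintegral_lintegral_swap ((hρ.comp measurable_fst).mul haq).aemeasurable
      _ = ∫⁻ y in A, ρ y ∂ν := lintegral_congr fun y => hρi y

/-- The measure of a set under an invariant measure is at most its probability under the noise
in the worst case. -/
theorem IsInvariantMeasure.measure_le {ε : ℝ} {f : ℝ → ℝ} {μ : Measure ℝ}
    (h : IsInvariantMeasure ε f μ) {A B : Set ℝ} (hA : MeasurableSet A) {M : ℝ≥0∞}
    (hM : ∀ x ∈ Icc (0 : ℝ) 1, x ∉ B → noise ε (f x) A ≤ M) (hε : 0 < ε) :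
    μ A ≤ M + μ B := by
  have := h.prob
  rw [← h.invariant A hA]
  have hle : ∀ᵐ x ∂μ, noise ε (f x) A ≤ M + B.indicator 1 x := by
    have h0 : ∀ᵐ x ∂μ, x ∈ Icc (0 : ℝ) 1 := h.supported
    filter_upwards [h0] with x hx
    by_cases hxB : x ∈ B
    · have := isProbabilityMeasure_noise hε (f x)
      simpa [hxB] using prob_le_one.trans le_add_self
    · simpa [hxB] using hM x hx hxB
  calc ∫⁻ x, noise ε (f x) A ∂μ ≤ ∫⁻ x, (M + B.indicator 1 x) ∂μ := lintegral_mono_ae hle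
    _ = M + ∫⁻ x, B.indicator 1 x ∂μ := by
        rw [lintegral_add_left measurable_const, lintegral_const, measure_univ, mul_one]
    _ ≤ M + μ B := by gcongr; exact lintegral_indicator_one_le B

/-- For a constant map the noise measure itself is invariant. -/
theorem isInvariantMeasure_const {ε : ℝ} (hε : 0 < ε) (u : ℝ) :
    IsInvariantMeasure ε (fun _ => u) (noise ε u) where
  prob := isProbabilityMeasure_noise hε u
  supported := noise_compl_Icc ε u
  invariant A _ := by rw [lintegral_const, noise_univ hε, mul_one]

/-! ### Analytic maps with prescribed values at finitely many points -/

theorem iteratedDeriv_eq_re {F : ℂ → ℂ} {f : ℝ → ℝ} (hF : ∀ x : ℝ, AnalyticAt ℂ F x)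
    (h : ∀ x : ℝ, F x = f x) (k : ℕ) (x : ℝ) :
    iteratedDeriv k f x = (iteratedDeriv k F x).re := by
  induction k generalizing x with
  | zero => simp [h]
  | succ k ih =>
    have h1 : HasDerivAt (iteratedDeriv k F) (iteratedDeriv (k + 1) F x) x := by
      rw [iteratedDeriv_succ]
      have : AnalyticAt ℂ (iteratedDeriv k F) x := by
        rw [iteratedDeriv_eq_iterate]
        exact (hF x).iterated_deriv k
      exact this.differentiableAt.hasDerivAt
    rw [iteratedDeriv_succ, funext ih]
    exact h1.real_of_complex.deriv

/-- By Cauchy's estimates, a map bounded by `1` on a complex strip of half-width `1 / η` satisfies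
the bounds on the derivatives. -/
theorem isAnalyticMap_of_strip {η : ℝ} (hη : 0 < η) {F : ℂ → ℂ} {f : ℝ → ℝ}
    (h : ∀ x : ℝ, F x = f x) (hfI : MapsTo f (Icc 0 1) (Icc 0 1))
    (hF : ∀ z : ℂ, |z.im| ≤ η⁻¹ → AnalyticAt ℂ F z)
    (hbd : ∀ z : ℂ, |z.im| ≤ η⁻¹ → ‖F z‖ ≤ 1) : IsAnalyticMap η f := by
  have hFx : ∀ x : ℝ, AnalyticAt ℂ F x := fun x => hF x (by simpa using hη.le)
  refine ⟨hfI, fun x _ => ?_, fun k x _ => ?_⟩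
  · have h1 : f = fun x : ℝ => (F x).re := funext fun x => by rw [h, Complex.ofReal_re]
    rw [h1]
    exact (hFx x).re_ofReal
  · have hstrip : ∀ z ∈ Metric.closedBall (x : ℂ) η⁻¹, |z.im| ≤ η⁻¹ := by
      intro z hz
      have h1 := Complex.abs_im_le_norm (z - x)
      rw [Complex.sub_im, Complex.ofReal_im, sub_zero] at h1
      exact h1.trans (by simpa [dist_eq_norm] using hz)
    have hη' : 0 < η⁻¹ := inv_pos.mpr hη
    have hdiff : DiffContOnCl ℂ F (Metric.ball (x : ℂ) η⁻¹) := by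
      refine DifferentiableOn.diffContOnCl fun z hz => ?_
      rw [closure_ball _ hη'.ne'] at hz
      exact (hF z (hstrip z hz)).differentiableAt.differentiableWithinAt
    have h2 := Complex.norm_iteratedDeriv_le_of_forall_mem_sphere_norm_le k hη' hdiff
      fun z hz => hbd z (hstrip z (Metric.sphere_subset_closedBall hz))
    rw [iteratedDeriv_eq_re hFx h]
    refine (Complex.abs_re_le_norm _).trans (h2.trans_eq ?_)
    rw [mul_one, inv_pow, div_inv_eq_mul]

/-- The function `∏ (x - p)² / ((x - p)² + w²)`, which vanishes at the points `p` of `X` and is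
close to `1` at points much farther than `w` from all of `X`. -/
noncomputable def notch (X : Finset ℝ) (w x : ℝ) : ℝ :=
  ∏ p ∈ X, (x - p) ^ 2 / ((x - p) ^ 2 + w ^ 2)

theorem notch_eq_zero {X : Finset ℝ} {p : ℝ} (hp : p ∈ X) (w : ℝ) : notch X w p = 0 :=
  Finset.prod_eq_zero hp (by simp)

theorem notch_factor_mem_Icc (w x p : ℝ) :
    (x - p) ^ 2 / ((x - p) ^ 2 + w ^ 2) ∈ Icc (0 : ℝ) 1 :=
  ⟨by positivity, div_le_one_of_le₀ (by linarith [sq_nonneg w]) (by positivity)⟩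

theorem notch_mem_Icc (X : Finset ℝ) (w x : ℝ) : notch X w x ∈ Icc (0 : ℝ) 1 :=
  ⟨Finset.prod_nonneg fun p _ => (notch_factor_mem_Icc w x p).1,
    Finset.prod_le_one (fun p _ => (notch_factor_mem_Icc w x p).1)
      fun p _ => (notch_factor_mem_Icc w x p).2⟩

theorem measurable_notch (X : Finset ℝ) (w : ℝ) : Measurable (notch X w) := by
  unfold notch
  fun_prop

theorem one_sub_le_notch {X : Finset ℝ} {w r x : ℝ} (hr : 0 < r)
    (hx : ∀ p ∈ X, r ≤ |x - p|) : 1 - X.card * (w ^ 2 / r ^ 2) ≤ notch X w x := by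
  unfold notch
  induction X using Finset.induction_on with
  | empty => simp
  | insert p X hp ih =>
    rw [Finset.prod_insert hp, Finset.card_insert_of_notMem hp]
    have h1 := ih fun p' hp' => hx p' (Finset.mem_insert_of_mem hp')
    have h2 : r ^ 2 ≤ (x - p) ^ 2 := by
      rw [← sq_abs (x - p)]
      exact pow_le_pow_left₀ hr.le (hx p (Finset.mem_insert_self p X)) 2
    have h3 : 1 - w ^ 2 / r ^ 2 ≤ (x - p) ^ 2 / ((x - p) ^ 2 + w ^ 2) := by
      have h4 : 0 < (x - p) ^ 2 + w ^ 2 := by linarith [pow_pos hr 2, sq_nonneg w]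
      have h5 : (x - p) ^ 2 / ((x - p) ^ 2 + w ^ 2) = 1 - w ^ 2 / ((x - p) ^ 2 + w ^ 2) := by
        field_simp
        ring
      rw [h5]
      gcongr
      linarith [sq_nonneg w]
    have h6 := notch_mem_Icc X w x
    unfold notch at h6
    have h7 : 0 ≤ w ^ 2 / r ^ 2 := by positivity
    have h8 := notch_factor_mem_Icc w x p
    push_cast
    nlinarith [mul_le_mul_of_nonneg_right h3 h6.1, mul_nonneg h7 (sub_nonneg.mpr h6.2)]

theorem notch_factor_denom {w : ℝ} (hw : 0 < w) {ζ : ℂ} (hζ : |ζ.im| ≤ w / 2) :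
    ζ ^ 2 + (w : ℂ) ^ 2 ≠ 0 ∧ ‖ζ ^ 2‖ ≤ ‖ζ ^ 2 + (w : ℂ) ^ 2‖ := by
  have h1 : ζ.im ^ 2 ≤ (w / 2) ^ 2 := by
    rw [← sq_abs ζ.im]
    exact pow_le_pow_left₀ (abs_nonneg _) hζ 2
  have h2 : Complex.normSq (ζ ^ 2) < Complex.normSq (ζ ^ 2 + (w : ℂ) ^ 2) := by
    simp only [Complex.normSq_apply, sq, Complex.add_re, Complex.add_im, Complex.mul_re,
      Complex.mul_im, Complex.ofReal_re, Complex.ofReal_im]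
    nlinarith [mul_pos hw hw, mul_nonneg (sq_nonneg w) (sq_nonneg ζ.re),
      mul_le_mul_of_nonneg_left h1 (sq_nonneg w), pow_pos hw 4]
  refine ⟨fun h => ?_, ?_⟩
  · rw [h, map_zero] at h2
    exact absurd h2 (not_lt.mpr (Complex.normSq_nonneg _))
  · rw [Complex.normSq_eq_norm_sq, Complex.normSq_eq_norm_sq] at h2
    exact (pow_le_pow_iff_left₀ (norm_nonneg _) (norm_nonneg _) two_ne_zero).mp h2.le

/-- The map equal to `1 / 4` on `X` and close to `3 / 4` away from `X` is analytic in a strip whose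
width does not depend on the number of points of `X`, and bounded by `1` there. The reason is that
`|ζ²| ≤ |ζ² + w²|` whenever `|Im ζ| ≤ w / 2`, so that every factor has norm at most `1`. -/
theorem isAnalyticMap_notch {η : ℝ} (hη : 0 < η) (X : Finset ℝ) :
    IsAnalyticMap η fun x => 1 / 4 + 1 / 2 * notch X (2 * η⁻¹) x := by
  have hη' : 0 < η⁻¹ := inv_pos.mpr hη
  have hw : 0 < 2 * η⁻¹ := by positivity
  have hden : ∀ z : ℂ, |z.im| ≤ η⁻¹ → ∀ p : ℝ,
      (z - p) ^ 2 + ((2 * η⁻¹ : ℝ) : ℂ) ^ 2 ≠ 0 ∧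
        ‖(z - p) ^ 2‖ ≤ ‖(z - p) ^ 2 + ((2 * η⁻¹ : ℝ) : ℂ) ^ 2‖ := fun z hz p => by
    refine notch_factor_denom hw ?_
    rwa [Complex.sub_im, Complex.ofReal_im, sub_zero, mul_div_cancel_left₀ _ two_ne_zero]
  refine isAnalyticMap_of_strip hη (F := fun z => 1 / 4 + 1 / 2 * ∏ p ∈ X,
    (z - p) ^ 2 / ((z - p) ^ 2 + ((2 * η⁻¹ : ℝ) : ℂ) ^ 2)) (fun x => ?_) (fun x _ => ?_)
    (fun z hz => ?_) fun z hz => ?_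
  · simp [notch]
  · have := notch_mem_Icc X (2 * η⁻¹) x
    constructor <;> linarith [this.1, this.2]
  · refine analyticAt_const.add (analyticAt_const.mul ?_)
    refine Finset.analyticAt_fun_prod _ fun p _ => ?_
    exact AnalyticAt.fun_div (by fun_prop) (by fun_prop) (hden z hz p).1
  · have hprod : ‖∏ p ∈ X, (z - p) ^ 2 / ((z - p) ^ 2 + ((2 * η⁻¹ : ℝ) : ℂ) ^ 2)‖ ≤ 1 := by
      rw [norm_prod]
      refine Finset.prod_le_one (fun p _ => norm_nonneg _) fun p _ => ?_
      rw [norm_div]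
      exact div_le_one_of_le₀ (hden z hz p).2 (norm_nonneg _)
    refine (norm_add_le _ _).trans ?_
    have h1 : ‖(1 / 4 : ℂ)‖ = 1 / 4 := by norm_num
    have h2 : ‖(1 / 2 : ℂ)‖ = 1 / 2 := by norm_num
    rw [norm_mul, h1, h2]
    linarith

theorem isAnalyticMap_const {η u : ℝ} (hη : 0 < η) (hu : u ∈ Icc (0 : ℝ) 1) :
    IsAnalyticMap η fun _ => u :=
  isAnalyticMap_of_strip hη (F := fun _ => (u : ℂ)) (fun _ => rfl) (fun _ _ => hu)
    (fun _ _ => analyticAt_const) fun _ _ => by simpa [abs_le] using ⟨by linarith [hu.1], hu.2⟩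

/-! ### The running time is at least the reciprocal of the noise -/

/-- If the map is at least `5 / 8` off a small neighbourhood of `X`, then an invariant measure
gives small weight to `[0, 1 / 2]`, because it gives small weight to that neighbourhood. -/
theorem IsInvariantMeasure.real_Icc_half_le {ε r : ℝ} {f : ℝ → ℝ} {μ : Measure ℝ} {X : Finset ℝ}
    (h : IsInvariantMeasure ε f μ) (hε : 0 < ε) (hε1 : ε ≤ 1) (hr : 0 ≤ r)
    (hfI : MapsTo f (Icc 0 1) (Icc 0 1))
    (hf : ∀ x, (∀ p ∈ X, r ≤ |x - p|) → 5 / 8 ≤ f x) :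
    μ.real (Icc 0 (1 / 2)) ≤ 300 * ε + 16 / (7 * ε) * (X.card * (2 * r)) := by
  let S : Set ℝ := ⋃ p ∈ X, Metric.ball p r
  have hS : MeasurableSet S := X.measurableSet_biUnion fun p _ => measurableSet_ball
  have hvol : volume (S ∩ Icc 0 1) ≤ ENNReal.ofReal (X.card * (2 * r)) := by
    refine (measure_mono inter_subset_left).trans ((measure_biUnion_finset_le _ _).trans ?_)
    simp only [Real.volume_ball]
    rw [Finset.sum_const, nsmul_eq_mul, ENNReal.ofReal_mul (Nat.cast_nonneg _),
      ENNReal.ofReal_natCast]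
  have h16 : 0 ≤ 16 / (7 * ε) := by positivity
  have hμS : μ S ≤ ENNReal.ofReal (16 / (7 * ε) * (X.card * (2 * r))) := by
    have := h.measure_le (B := ∅) hS (fun x hx _ => (noise_le_mul_volume hS fun y _ =>
      noiseKernel_le hε hε1 (hfI hx) y).trans (mul_le_mul_right hvol _)) hε
    rwa [measure_empty, add_zero, ← ENNReal.ofReal_mul h16] at this
  refine ENNReal.toReal_le_of_le_ofReal (by positivity) ?_
  rw [ENNReal.ofReal_add (by positivity) (by positivity)]
  refine (h.measure_le (B := S) measurableSet_Icc (fun x hx hxS => ?_) hε).trans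
    (add_le_add_right hμS _)
  refine noise_le_of_far hε hε1 (hfI hx) measurableSet_Icc fun y hy => ?_
  have h1 : 5 / 8 ≤ f x := hf x fun p hp => by
    by_contra hlt
    exact hxS (mem_biUnion hp (by simpa [Real.dist_eq] using hlt))
  rw [abs_sub_comm]
  exact (by linarith [hy.2] : 1 / 8 ≤ f x - y).trans (le_abs_self _)

/-- Noise centred at `1 / 4` mostly stays in `[0, 1 / 2]`. -/
theorem le_noise_real_Icc_half {ε : ℝ} (hε : 0 < ε) (hε1 : ε ≤ 1) :
    1 - 300 * ε ≤ (noise ε (1 / 4)).real (Icc 0 (1 / 2)) := by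
  have := isProbabilityMeasure_noise hε (1 / 4)
  have h1 : (noise ε (1 / 4)).real (Ioc (1 / 2) 1) ≤ 300 * ε :=
    ENNReal.toReal_le_of_le_ofReal (by positivity)
      (noise_le_of_far hε hε1 (by norm_num) measurableSet_Ioc fun y hy =>
        (by linarith [hy.1] : 1 / 8 ≤ y - 1 / 4).trans (le_abs_self _))
  have h2 : (noise ε (1 / 4)).real (Icc 0 1) = 1 := by
    have h3 := probReal_add_probReal_compl (μ := noise ε (1 / 4))
      (measurableSet_Icc (a := (0 : ℝ)) (b := 1))
    rwa [measureReal_def (s := (Icc (0 : ℝ) 1)ᶜ), noise_compl_Icc, ENNReal.toReal_zero,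
      add_zero] at h3
  have h3 : (noise ε (1 / 4)).real (Icc 0 1) ≤ _ + _ :=
    (congrArg _ (Icc_union_Ioc_eq_Icc (by norm_num : (0 : ℝ) ≤ 1 / 2) (by norm_num)).symm).trans_le
      (measureReal_union_le (Icc (0 : ℝ) (1 / 2)) (Ioc (1 / 2) 1))
  linarith

theorem dyadic_nonneg (l : List Bool) : 0 ≤ dyadic l := by
  induction l with
  | nil => exact le_rfl
  | cons b l ih => cases b <;> simp [dyadic] <;> linarith

/-- The point at which a query `w` evaluates the map. -/
noncomputable def queryPoint (w : List Sym) : ℝ :=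
  min 1 (dyadic (w.takeWhile Option.isSome).reduceOption)

theorem answer_congr {f g : ℝ → ℝ} {w : List Sym} (h : f (queryPoint w) = g (queryPoint w)) :
    answer f w = answer g w := by
  unfold queryPoint at h
  simp only [answer, h]

theorem dyadic_half : dyadic [false, true] = 1 / 2 := by norm_num [dyadic]

theorem ComputesInvariantMeasures.exists_haltsWith {K : ℕ} {A : Machine}
    (hA : ComputesInvariantMeasures K A) (e n : ℕ) {f : ℝ → ℝ}
    (hf : IsAnalyticMap ((1 / (1 / 2 : ℝ) ^ e) ^ K) f) :
    ∃ out : List Bool, A.HaltsWith f (inputWord e n [] [false, true]) out ∧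
      ∀ μ : Measure ℝ, IsInvariantMeasure ((1 / 2 : ℝ) ^ e) f μ →
        |dyadic out - μ.real (Icc 0 (1 / 2))| ≤ (1 / 2 : ℝ) ^ n := by
  have := hA e n f [] [false, true] ⟨hf, dyadic_nonneg _, by rw [dyadic_half]; norm_num⟩
  rwa [dyadic_half] at this

/-- An algorithm that computes invariant measures makes more than `1 / ε` steps on the constant
map `1 / 4`: the map that equals `1 / 4` at the points it asks about and is close to `3 / 4`
elsewhere has a very different invariant measure. -/
theorem ComputesInvariantMeasures.two_pow_lt_haltingTime {A : Machine}
    (hA : ComputesInvariantMeasures 4 A) {e n T : ℕ} (he : 12 ≤ e) (hn : 2 ≤ n)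
    (hT : A.IsHaltingTime (fun _ => 1 / 4) (inputWord e n [] [false, true]) T) : 2 ^ e < T := by
  by_contra! hTe
  set inp := inputWord e n [] [false, true] with hinp
  set ε : ℝ := (1 / 2) ^ e with hεdef
  have hε : 0 < ε := by positivity
  have hεs : ε ≤ 1 / 4096 := by
    calc ε ≤ (1 / 2) ^ 12 := pow_le_pow_of_le_one (by norm_num) (by norm_num) he
      _ = 1 / 4096 := by norm_num
  have hη : 0 < (1 / ε) ^ 4 := by positivity
  have hηinv : ((1 / ε) ^ 4)⁻¹ = ε ^ 4 := by rw [one_div, inv_pow, inv_inv]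
  let X : Finset ℝ :=
    (Finset.range T).image fun t => queryPoint (A.run (fun _ => 1 / 4) inp t).query
  have hX : (X.card : ℝ) ≤ ε⁻¹ := by
    have h1 : X.card ≤ 2 ^ e := (Finset.card_image_le.trans_eq (Finset.card_range T)).trans hTe
    rw [hεdef, ← inv_pow, one_div, inv_inv]
    exact_mod_cast h1
  let g : ℝ → ℝ := fun x => 1 / 4 + 1 / 2 * notch X (2 * ((1 / ε) ^ 4)⁻¹) x
  have hg : IsAnalyticMap ((1 / ε) ^ 4) g := isAnalyticMap_notch hη X
  obtain ⟨out, hout, hμ⟩ := hA.exists_haltsWith e n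
    (isAnalyticMap_const hη (by norm_num : (1 / 4 : ℝ) ∈ Icc (0 : ℝ) 1))
  obtain ⟨out', hout', hμ'⟩ := hA.exists_haltsWith e n hg
  have hrun : A.run g inp T = A.run (fun _ => 1 / 4) inp T := by
    refine Machine.run_congr (fun t ht => answer_congr ?_) T le_rfl
    have hmem : queryPoint (A.run (fun _ => 1 / 4) inp t).query ∈ X :=
      Finset.mem_image_of_mem _ (Finset.mem_range.mpr ht)
    simp only [g]
    rw [notch_eq_zero hmem]
    ring
  have hsame : out = out' := by
    have h1 : A.HaltsWith (fun _ => 1 / 4) inp (A.run (fun _ => 1 / 4) inp T).output :=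
      ⟨T, hT.1, rfl⟩
    have h2 : A.HaltsWith g inp (A.run (fun _ => 1 / 4) inp T).output :=
      ⟨T, by rw [hrun]; exact hT.1, by rw [hrun]⟩
    rw [hout.unique h1, hout'.unique h2]
  have hgI : ∀ x, g x ∈ Icc (0 : ℝ) 1 := fun x => by
    have := notch_mem_Icc X (2 * ((1 / ε) ^ 4)⁻¹) x
    constructor <;> simp only [g] <;> linarith [this.1, this.2]
  obtain ⟨μ, hμg⟩ := exists_isInvariantMeasure hε
    (((measurable_notch X _).const_mul _).const_add _ : Measurable g) hgI
  -- At distance `ε³` from `X` the deviation from `3 / 4` is at most `|X| (2ε⁴ / ε³)² ≤ 4 ε`.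
  have hfar : ∀ x, (∀ p ∈ X, ε ^ 3 ≤ |x - p|) → 5 / 8 ≤ g x := by
    intro x hx
    have h1 := one_sub_le_notch (w := 2 * ((1 / ε) ^ 4)⁻¹) (by positivity : 0 < ε ^ 3) hx
    have h2 : X.card * ((2 * ((1 / ε) ^ 4)⁻¹) ^ 2 / (ε ^ 3) ^ 2) ≤ 4 * ε := by
      rw [hηinv]
      calc X.card * ((2 * ε ^ 4) ^ 2 / (ε ^ 3) ^ 2) = X.card * (4 * ε ^ 2) := by
            field_simp
            ring
        _ ≤ ε⁻¹ * (4 * ε ^ 2) := by gcongr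
        _ = 4 * ε := by field_simp
    simp only [g]
    linarith
  have hnbhd : 16 / (7 * ε) * (X.card * (2 * ε ^ 3)) ≤ 5 * ε := by
    calc 16 / (7 * ε) * (X.card * (2 * ε ^ 3)) ≤ 16 / (7 * ε) * (ε⁻¹ * (2 * ε ^ 3)) := by gcongr
      _ = 32 / 7 * ε := by field_simp; ring
      _ ≤ 5 * ε := by gcongr; norm_num
  have hlow := (hμg.real_Icc_half_le hε (by linarith) (by positivity) (fun x _ => hgI x)
    hfar).trans (add_le_add_right hnbhd _)
  have hhigh := le_noise_real_Icc_half hε (by linarith : ε ≤ 1)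
  have hδ : (1 / 2 : ℝ) ^ n ≤ 1 / 4 := by
    calc (1 / 2 : ℝ) ^ n ≤ (1 / 2) ^ 2 := pow_le_pow_of_le_one (by norm_num) (by norm_num) hn
      _ = 1 / 4 := by norm_num
  have h1 := abs_le.mp (hμ _ (isInvariantMeasure_const hε (1 / 4)))
  have h2 := abs_le.mp (hμ' _ hμg)
  rw [hsame] at h1
  linarith only [h1.1, h2.2, hlow, hhigh, hδ, hεs]

/-! ### The running time is at least the number of digits of the result -/

theorem gaussWeight_far_le {ε y z u : ℝ} (hε : 0 < ε) (hε1 : ε ≤ 1)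
    (h : (y - u) ^ 2 + 1 / 4 ≤ (z - u) ^ 2) :
    gaussWeight ε z u ≤ 8 / 9 * gaussWeight ε y u := by
  have h1 : gaussWeight ε z u ≤ Real.exp (-(1 / 8)) * gaussWeight ε y u := by
    unfold gaussWeight
    rw [← Real.exp_add, neg_div, neg_div, ← neg_add]
    refine Real.exp_le_exp.mpr (neg_le_neg ?_)
    rw [le_div_iff₀ (by positivity), add_mul, div_mul_cancel₀ _ (by positivity)]
    nlinarith
  have h2 : Real.exp (-(1 / 8)) ≤ 8 / 9 := by
    rw [Real.exp_neg]
    refine inv_le_of_inv_le₀ (by norm_num) ?_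
    linarith [Real.add_one_le_exp (1 / 8 : ℝ)]
  exact h1.trans (mul_le_mul_of_nonneg_right h2 (gaussWeight_pos ε y u).le)

theorem integral_gaussWeight_add_half (ε u : ℝ) :
    ∫ y in (0 : ℝ)..(1 / 2), gaussWeight ε (y + 1 / 2) u =
      ∫ y in (1 / 2 : ℝ)..1, gaussWeight ε y u := by
  rw [intervalIntegral.integral_comp_add_right fun y => gaussWeight ε y u]
  norm_num

theorem intervalIntegrable_gaussWeight_add_half (ε u a b : ℝ) :
    IntervalIntegrable (fun y => gaussWeight ε (y + 1 / 2) u) volume a b :=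
  ((continuous_gaussWeight ε).comp
    (by fun_prop : Continuous fun y : ℝ => (y + 1 / 2, u))).intervalIntegrable a b

theorem integral_gaussWeight_zero_le {ε : ℝ} (hε : 0 < ε) (hε1 : ε ≤ 1) :
    ∫ y in (1 / 2 : ℝ)..1, gaussWeight ε y 0 ≤
      8 / 9 * ∫ y in (0 : ℝ)..(1 / 2), gaussWeight ε y 0 := by
  rw [← integral_gaussWeight_add_half, ← intervalIntegral.integral_const_mul]
  refine intervalIntegral.integral_mono_on (by norm_num)
    (intervalIntegrable_gaussWeight_add_half ε 0 _ _)
    ((intervalIntegrable_gaussWeight ε 0 _ _).const_mul _) fun y hy => ?_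
  exact gaussWeight_far_le hε hε1 (by nlinarith [hy.1])

theorem integral_gaussWeight_one_le {ε : ℝ} (hε : 0 < ε) (hε1 : ε ≤ 1) :
    ∫ y in (0 : ℝ)..(1 / 2), gaussWeight ε y 1 ≤
      8 / 9 * ∫ y in (1 / 2 : ℝ)..1, gaussWeight ε y 1 := by
  rw [← integral_gaussWeight_add_half, ← intervalIntegral.integral_const_mul]
  refine intervalIntegral.integral_mono_on (by norm_num) (intervalIntegrable_gaussWeight ε 1 _ _)
    ((intervalIntegrable_gaussWeight_add_half ε 1 _ _).const_mul _) fun y hy => ?_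
  exact gaussWeight_far_le hε hε1 (by nlinarith [hy.2])

/-- As the constant value of the map moves from `0` to `1`, the invariant measure of `[0, 1 / 2]`
takes all values in an interval around `1 / 2` that does not depend on `ε`. -/
theorem exists_noise_real_Icc_half_eq {ε v : ℝ} (hε : 0 < ε) (hε1 : ε ≤ 1)
    (hv : v ∈ Icc (8 / 17 : ℝ) (9 / 17)) :
    ∃ u ∈ Icc (0 : ℝ) 1, (noise ε u).real (Icc 0 (1 / 2)) = v := by
  let G : ℝ → ℝ := fun u =>
    (∫ y in (0 : ℝ)..(1 / 2), gaussWeight ε y u) / ∫ y in (0 : ℝ)..1, gaussWeight ε y u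
  have hG : Continuous G := (continuous_integral_gaussWeight ε 0 (1 / 2)).div
    (continuous_integral_gaussWeight ε 0 1) fun u => (integral_gaussWeight_pos ε u).ne'
  have hsum : ∀ u, (∫ y in (0 : ℝ)..(1 / 2), gaussWeight ε y u) +
      ∫ y in (1 / 2 : ℝ)..1, gaussWeight ε y u = ∫ y in (0 : ℝ)..1, gaussWeight ε y u :=
    fun u => intervalIntegral.integral_add_adjacent_intervals
      (intervalIntegrable_gaussWeight ε u _ _) (intervalIntegrable_gaussWeight ε u _ _)
  have h0 : 9 / 17 ≤ G 0 := by
    rw [le_div_iff₀ (integral_gaussWeight_pos ε 0)]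
    linarith [hsum 0, integral_gaussWeight_zero_le hε hε1]
  have h1 : G 1 ≤ 8 / 17 := by
    rw [div_le_iff₀ (integral_gaussWeight_pos ε 1)]
    linarith [hsum 1, integral_gaussWeight_one_le hε hε1]
  obtain ⟨u, hu, huv⟩ := intermediate_value_Icc' zero_le_one hG.continuousOn
    ⟨h1.trans hv.1, hv.2.trans h0⟩
  refine ⟨u, hu, ?_⟩
  rw [measureReal_def, noise_Icc hε le_rfl (by norm_num) (by norm_num),
    ENNReal.toReal_ofReal, ← huv]
  exact div_nonneg (intervalIntegral.integral_nonneg (by norm_num)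
    fun y _ => (gaussWeight_pos ε y u).le) (integral_gaussWeight_pos ε u).le

theorem exists_dyadic_mul_two_pow_eq {l : List Bool} {m : ℕ} (h : l.length ≤ m + 1) :
    ∃ k : ℕ, dyadic l * 2 ^ m = k := by
  induction l generalizing m with
  | nil => exact ⟨0, by simp [dyadic]⟩
  | cons b l ih =>
    obtain ⟨i, hi⟩ : ∃ i : ℕ, (if b then (1 : ℝ) else 0) = i := by
      cases b
      · exact ⟨0, by simp⟩
      · exact ⟨1, by simp⟩
    rw [dyadic, hi]
    cases m with
    | zero =>
      have hl : l = [] := List.length_eq_zero_iff.mp (by simpa using h)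
      exact ⟨i, by simp [hl, dyadic]⟩
    | succ m =>
      obtain ⟨k, hk⟩ := ih (m := m) (by simpa using h)
      refine ⟨i * 2 ^ (m + 1) + k, ?_⟩
      push_cast
      rw [← hk]
      ring

/-- The number `1 / 2 + 2 · 2⁻ⁿ` is halfway between two multiples of `2 ^ (2 - n)`, so that fewer
than `n` binary digits do not suffice for approximating it with precision `2⁻ⁿ`. -/
theorem le_length_of_abs_dyadic_sub_le {l : List Bool} {n : ℕ} (hn : 3 ≤ n)
    (h : |dyadic l - (1 / 2 + 2 * (1 / 2) ^ n)| ≤ (1 / 2 : ℝ) ^ n) : n ≤ l.length := by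
  by_contra! hlt
  obtain ⟨m, rfl⟩ : ∃ m, n = m + 3 := ⟨n - 3, by omega⟩
  obtain ⟨k, hk⟩ := exists_dyadic_mul_two_pow_eq (l := l) (m := m + 1) (by omega)
  have hpow : (1 / 2 : ℝ) ^ (m + 3) * 2 ^ (m + 1) = 1 / 4 := by
    rw [show m + 3 = m + 1 + 2 by ring, pow_add (1 / 2 : ℝ), mul_right_comm, ← mul_pow]
    norm_num
  have hpos : (0 : ℝ) < 2 ^ (m + 1) := by positivity
  obtain ⟨h1, h2⟩ := abs_le.mp h
  have h3 := mul_le_mul_of_nonneg_right h1 hpos.le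
  have h4 := mul_le_mul_of_nonneg_right h2 hpos.le
  have h5 : (dyadic l - (1 / 2 + 2 * (1 / 2) ^ (m + 3))) * 2 ^ (m + 1) =
      k - (2 ^ m + 1 / 2) := by
    rw [← hk]
    linear_combination (-2 : ℝ) * hpow
  rw [h5, hpow] at h4
  rw [h5, neg_mul, hpow] at h3
  have h6 : ((2 ^ m : ℕ) : ℝ) < k := by push_cast; linarith
  have h7 : (k : ℝ) < ((2 ^ m + 1 : ℕ) : ℝ) := by push_cast; linarith
  have h8 : 2 ^ m < k := by exact_mod_cast h6
  have h9 : k < 2 ^ m + 1 := by exact_mod_cast h7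
  omega

/-- On a suitable constant map an algorithm that computes invariant measures has to write at least
`n` digits, and hence to make at least `n` steps. -/
theorem ComputesInvariantMeasures.exists_le_haltingTime {A : Machine} {K : ℕ}
    (hA : ComputesInvariantMeasures K A) (e : ℕ) {n : ℕ} (hn : 7 ≤ n) :
    ∃ u ∈ Icc (0 : ℝ) 1, ∃ T,
      A.IsHaltingTime (fun _ => u) (inputWord e n [] [false, true]) T ∧ n ≤ T := by
  have hε : (0 : ℝ) < (1 / 2) ^ e := by positivity
  have hδ : (1 / 2 : ℝ) ^ n ≤ 1 / 128 := by
    calc (1 / 2 : ℝ) ^ n ≤ (1 / 2) ^ 7 := pow_le_pow_of_le_one (by norm_num) (by norm_num) hn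
      _ = 1 / 128 := by norm_num
  have hδ0 : (0 : ℝ) < (1 / 2) ^ n := by positivity
  obtain ⟨u, hu, hv⟩ := exists_noise_real_Icc_half_eq (v := 1 / 2 + 2 * (1 / 2) ^ n) hε
    (pow_le_one₀ (by norm_num) (by norm_num)) (by constructor <;> linarith)
  obtain ⟨out, hout, hμ⟩ := hA.exists_haltsWith e n (isAnalyticMap_const (by positivity) hu)
  obtain ⟨T, hT, rfl⟩ := hout.exists_isHaltingTime
  refine ⟨u, hu, T, hT, ?_⟩
  have h1 := hμ _ (isInvariantMeasure_const hε u)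
  rw [hv] at h1
  exact (le_length_of_abs_dyadic_sub_le (by omega) h1).trans (Machine.length_output_run_le T)

/-! ### From time to space -/

theorem length_inputWord_half (e n : ℕ) :
    (inputWord e n [] [false, true]).length = e.size + n.size + 6 := by
  simp [inputWord, Nat.size_eq_bits_len]
  omega

theorem spaceBound_half_pow (e : ℕ) {n : ℕ} (hn : 1 ≤ n) :
    spaceBound ((1 / 2 : ℝ) ^ e) ((1 / 2 : ℝ) ^ n) =
      e * Real.log 2 + (Real.log n + Real.log (Real.log 2)) := by
  have hn0 : (n : ℝ) ≠ 0 := by positivity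
  have h : ∀ k : ℕ, Real.log (1 / (1 / 2 : ℝ) ^ k) = k * Real.log 2 := fun k => by
    rw [one_div, ← inv_pow, one_div, inv_inv, Real.log_pow]
  rw [spaceBound, h, h, Real.log_mul hn0 (Real.log_pos one_lt_two).ne']

theorem neg_one_le_log_log_two : -1 ≤ Real.log (Real.log 2) := by
  have h := Real.log_two_gt_d9
  rw [Real.le_log_iff_exp_le (by linarith)]
  have h1 := Real.exp_one_gt_d9
  rw [Real.exp_neg]
  exact (inv_le_of_inv_le₀ (by norm_num) (by norm_num; linarith)).trans
    (by linarith : (1 / 2 : ℝ) ≤ _)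

/-- The input word is short: its length is linear in the space bound itself. -/
theorem length_inputWord_half_le (e : ℕ) {n : ℕ} (hn : 1 ≤ n) :
    ((inputWord e n [] [false, true]).length : ℝ) + 1 ≤
      10 + 2 * spaceBound ((1 / 2 : ℝ) ^ e) ((1 / 2 : ℝ) ^ n) := by
  have hlog := Real.log_two_gt_d9
  have he : (e.size : ℝ) ≤ e := by exact_mod_cast Nat.size_le.mpr e.lt_two_pow_self
  have hn1 : ((n.size - 1 : ℕ) : ℝ) * Real.log 2 ≤ Real.log n := by
    rw [← Real.log_pow]
    refine Real.log_le_log (by positivity) ?_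
    have h1 : 0 < n.size := Nat.size_pos.mpr hn
    exact_mod_cast Nat.lt_size.mp (Nat.sub_lt h1 one_pos)
  have hn2 : (n.size : ℝ) ≤ (n.size - 1 : ℕ) + 1 := by
    exact_mod_cast Nat.le_add_of_sub_le le_rfl
  have he0 : (0 : ℝ) ≤ e := Nat.cast_nonneg e
  have hn0 : (0 : ℝ) ≤ (n.size - 1 : ℕ) := Nat.cast_nonneg _
  rw [length_inputWord_half, spaceBound_half_pow e hn]
  push_cast
  nlinarith [neg_one_le_log_log_two]

/-- An algorithm that computes invariant measures needs running time at least exponential in the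
space bound: at least `1 / ε` for the noise, and at least `n` for the precision. -/
theorem ComputesInvariantMeasures.exists_spaceBound_le_log {A : Machine}
    (hA : ComputesInvariantMeasures 4 A) {e n : ℕ} (hn : 2 ≤ n)
    (hB : 24 ≤ spaceBound ((1 / 2 : ℝ) ^ e) ((1 / 2 : ℝ) ^ n)) :
    ∃ u ∈ Icc (0 : ℝ) 1, ∃ T,
      A.IsHaltingTime (fun _ => u) (inputWord e n [] [false, true]) T ∧ 1 ≤ T ∧
        spaceBound ((1 / 2 : ℝ) ^ e) ((1 / 2 : ℝ) ^ n) / 2 ≤ Real.log T := by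
  have hsb := spaceBound_half_pow e (by omega : 1 ≤ n)
  have hlog0 := Real.log_pos one_lt_two
  have hlog1 := Real.log_two_lt_d9
  set Λ := spaceBound ((1 / 2 : ℝ) ^ e) ((1 / 2 : ℝ) ^ n)
  rcases le_total (Λ / 2) (e * Real.log 2) with h | h
  · have he : 12 ≤ e := by
      have : (12 : ℝ) ≤ e := by nlinarith [(Nat.cast_nonneg e : (0 : ℝ) ≤ e)]
      exact_mod_cast this
    have hu : (1 / 4 : ℝ) ∈ Icc (0 : ℝ) 1 := by norm_num
    obtain ⟨out, hout, -⟩ := hA.exists_haltsWith e n (isAnalyticMap_const (by positivity) hu)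
    obtain ⟨T, hT, -⟩ := hout.exists_isHaltingTime
    have hlt := hA.two_pow_lt_haltingTime he hn hT
    refine ⟨1 / 4, hu, T, hT, Nat.one_le_two_pow.trans hlt.le, h.trans ?_⟩
    rw [← Real.log_pow]
    exact Real.log_le_log (by positivity) (by exact_mod_cast hlt.le)
  · have hlog2 : Real.log (Real.log 2) ≤ 0 := Real.log_nonpos hlog0.le (by linarith)
    have h12 : 12 ≤ Real.log n := by linarith
    have hn7 : 7 ≤ n := by
      have : (7 : ℝ) ≤ n := by
        linarith [Real.log_le_sub_one_of_pos (by positivity : (0 : ℝ) < n)]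
      exact_mod_cast this
    obtain ⟨u, hu, T, hT, hnT⟩ := hA.exists_le_haltingTime e hn7
    refine ⟨u, hu, T, hT, by omega, ?_⟩
    have : Real.log n ≤ Real.log T :=
      Real.log_le_log (by positivity) (by exact_mod_cast hnT)
    linarith

theorem Machine.workPos_lt_of_space_lt {A : Machine} {f : ℝ → ℝ} {inp : List Sym} {m : ℕ}
    (h : A.space f inp < (m : ℕ∞)) :
    ∃ s : ℕ, s < m ∧ ∀ t, (A.run f inp t).workPos < s := by
  obtain ⟨s, hs⟩ := ENat.ne_top_iff_exists.mp h.ne_top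
  refine ⟨s, by rw [← hs] at h; exact_mod_cast h, fun t => ?_⟩
  have h1 : (((A.run f inp t).workPos + 1 : ℕ) : ℕ∞) ≤ A.space f inp :=
    le_iSup (fun t => (((A.run f inp t).workPos + 1 : ℕ) : ℕ∞)) t
  rw [← hs] at h1
  exact_mod_cast h1

end NoisySystem

theorem theorem3 :
    ∃ K : ℕ, ∀ A : NoisySystem.Machine, NoisySystem.ComputesInvariantMeasures K A →
      ∃ c : ℝ, 0 < c ∧ ∃ B : ℝ, ∀ e n : ℕ, 2 ≤ n →
        B ≤ NoisySystem.spaceBound ((1 / 2 : ℝ) ^ e) ((1 / 2 : ℝ) ^ n) →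
          ∃ (f : ℝ → ℝ) (a b : List Bool), NoisySystem.IsInstance K e f a b ∧
            ((⌈c * NoisySystem.spaceBound ((1 / 2 : ℝ) ^ e) ((1 / 2 : ℝ) ^ n)⌉₊ : ℕ) : ℕ∞) ≤
              A.space f (NoisySystem.inputWord e n a b) := by
  refine ⟨4, fun A hA => ?_⟩
  obtain ⟨C, hC, hspace⟩ := A.exists_log_le_space
  refine ⟨1 / (4 * C), by positivity, 100, fun e n hn hB => ?_⟩
  have hlen := NoisySystem.length_inputWord_half_le e (by omega : 1 ≤ n)
  obtain ⟨u, hu, T, hT, hT1, hlog⟩ := hA.exists_spaceBound_le_log hn (by linarith)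
  set Λ := NoisySystem.spaceBound ((1 / 2 : ℝ) ^ e) ((1 / 2 : ℝ) ^ n)
  refine ⟨fun _ => u, [], [false, true],
    ⟨NoisySystem.isAnalyticMap_const (by positivity) hu, NoisySystem.dyadic_nonneg _,
      by rw [NoisySystem.dyadic_half]; norm_num⟩, ?_⟩
  by_contra! hlt
  obtain ⟨s, hs, hpos⟩ := NoisySystem.Machine.workPos_lt_of_space_lt hlt
  have h1 := hspace _ _ T s hT hT1 hpos
  have h2 : Real.log ((NoisySystem.inputWord e n [] [false, true]).length + 1) ≤
      Λ / 32 + 5 / 32 + 6 * Real.log 2 := by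
    refine (Real.log_le_log (by positivity) hlen).trans ?_
    have h3 := Real.log_le_sub_one_of_pos
      (div_pos (by linarith only [hB] : 0 < 10 + 2 * Λ) (by norm_num : (0 : ℝ) < 2 ^ 6))
    rw [Real.log_div (by linarith only [hB]) (by norm_num), Real.log_pow,
      show (10 + 2 * Λ) / 2 ^ 6 = 5 / 32 + Λ / 32 by ring] at h3
    push_cast at h3
    linarith only [h3]
  have h4 : C * s < Λ / 4 := by
    calc C * s < C * (1 / (4 * C) * Λ) := mul_lt_mul_of_pos_left (Nat.lt_ceil.mp hs) hC
      _ = Λ / 4 := by field_simp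
  linarith only [h1, h2, h4, hlog, hB, Real.log_two_lt_d9]
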